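/- Let $\mathcal{G}_{n,1}$ be the Grassmann manifold of complex lines in $\mathbb{C}^n$, with its canonical (quotient of the unit sphere by phases) Riemannian metric: if $u(t)$ is a $C^1$ curve of unit vectors, the path of lines spanned by $u(t)$ has speed $\|u' - (u^*u')u\|$. Let $x_1 = x[k]$ and $x_2 = x[k+1]$ be unit-norm representatives of two points $X_1, X_2\in\mathcal{G}_{n,1}$ with $\rho = x_1^* x_2 \neq 0$, let $d=\sqrt{1-|\rho|^2}$, and let $$e = \tan^{-1}\!\left(\frac{d}{|\rho|}\right)\frac{x_2/\rho - x_1}{\|x_2/\rho - x_1\|}$$ be the tangent vector emanating from $x_1$ to $x_2$ ($e=0$ if $X_1=X_2$), with normalization $\vec e = e/\|e\|$. Put $$G(x_1,e,t) = x_1\cos(\|e\|t) + \vec e\,\sin(\|e\|t)$$ (the second term being $0$ if $e = 0$). Then $\|G(x_1,e,t)\| = 1$ for all $t\in[0,1]$; $G(x_1,e,0)=x_1$; $G(x_1,e,1)$ is a unit vector spanning $X_2$, i.e. it equals $x_2$ as a point of $\mathcal{G}_{n,1}$; and $e$ is indeed a tangent vector at $x_1$ and the initial velocity of the curve: $x_1^*e=0$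 and $\frac{d}{dt}G(x_1,e,t)|_{t=0}=e$. Moreover the path $\gamma$ in $\mathcal{G}_{n,1}$ traced by $G(x_1,e,t)$, $t\in[0,1]$, is the geodesic from $X_1$ to $X_2$: it satisfies the geodesic equation (it has a horizontal $C^2$ lift to the unit sphere whose acceleration has zero horizontal part), it has constant speed and is of minimal length among all $C^1$ paths from $X_1$ to $X_2$, and it is the only constant-speed $C^1$ path on $[0,1]$ from $X_1$ to $X_2$ with minimal length. -/

import Mathlib

open Set
open scoped LinearAlgebra.Projectivization ComplexConjugate

noncomputable section

/-- The ambient Hermitian space `ℂⁿ` with its Euclidean norm. -/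
abbrev Cn (n : ℕ) : Type := EuclideanSpace ℂ (Fin n)

/-- The Grassmann manifold of complex lines in `ℂⁿ`. -/
abbrev GrassmannLine (n : ℕ) : Type := ℙ ℂ (Cn n)

/-- `x` is a unit-norm representative of the line `X`, i.e. `X` is spanned by the unit vector `x`.
Such an `x` is determined by `X` up to a phase factor. -/
def Represents {n : ℕ} (x : Cn n) (X : GrassmannLine n) : Prop :=
  ‖x‖ = 1 ∧ X.submodule = Submodule.span ℂ {x}

/-- The chordal distance `√(1 - |ρ|²)`, `ρ = x* y`, of the lines spanned by unit vectors. -/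
def chordalDist {n : ℕ} (x y : Cn n) : ℝ :=
  Real.sqrt (1 - ‖inner ℂ x y‖ ^ 2)

/-- The tangent vector emanating from `x` to `y`:
`arctan (d / |ρ|) (y / ρ - x) / ‖y / ρ - x‖` with `ρ = x* y ≠ 0` (it is `0` if the lines agree). -/
def tangentVec {n : ℕ} (x y : Cn n) : Cn n :=
  Real.arctan (chordalDist x y / ‖inner ℂ x y‖) •
    (‖(inner ℂ x y)⁻¹ • y - x‖⁻¹ • ((inner ℂ x y)⁻¹ • y - x))

/-- The curve `G(x, e, t) = x cos (‖e‖ t) + (e / ‖e‖) sin (‖e‖ t)` (constant if `e = 0`). -/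
def geodesicCurve {n : ℕ} (x e : Cn n) (t : ℝ) : Cn n :=
  Real.cos (‖e‖ * t) • x + Real.sin (‖e‖ * t) • (‖e‖⁻¹ • e)

/-- The component of `v` orthogonal to the complex line through the unit vector `x`
(the horizontal component, which is how tangent vectors to the space of lines are represented). -/
def horizontalPart {n : ℕ} (x v : Cn n) : Cn n :=
  v - inner ℂ x v • x

/-- `u` is a `C¹` curve of unit vectors on `[0, 1]` which represents the path of lines `γ`. -/
structure IsLift {n : ℕ} (u : ℝ → Cn n) (γ : ℝ → GrassmannLine n) : Prop where
  contDiffOn : ContDiffOn ℝ 1 u (Icc 0 1)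
  represents : ∀ t ∈ Icc (0 : ℝ) 1, Represents (u t) (γ t)

/-- The speed at time `t`, in the canonical (quotient) Riemannian metric of the space of lines,
of the path of lines on `[0, 1]` represented by the curve `u` of unit vectors. -/
def speed {n : ℕ} (u : ℝ → Cn n) (t : ℝ) : ℝ :=
  ‖horizontalPart (u t) (derivWithin u (Icc 0 1) t)‖

/-- The Riemannian length of the path of lines on `[0, 1]` represented by `u`. -/
def pathLength {n : ℕ} (u : ℝ → Cn n) : ℝ :=
  ∫ t in (0 : ℝ)..1, speed u t

/-- The speed does not depend on the choice of the lift, so it is a function of the path of lines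
alone. -/
theorem IsLift.speed_eq {n : ℕ} {u v : ℝ → Cn n} {γ : ℝ → GrassmannLine n}
    (hu : IsLift u γ) (hv : IsLift v γ) {t : ℝ} (ht : t ∈ Icc (0 : ℝ) 1) :
    speed u t = speed v t := by
  have key : ∀ s ∈ Icc (0 : ℝ) 1, v s = inner ℂ (u s) (v s) • u s := by
    intro s hs
    obtain ⟨hu1, hu2⟩ := hu.represents s hs
    obtain ⟨-, hv2⟩ := hv.represents s hs
    have hmem : v s ∈ Submodule.span ℂ {u s} := by
      rw [← hu2, hv2]
      exact Submodule.mem_span_singleton_self _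
    obtain ⟨a, ha⟩ := Submodule.mem_span_singleton.1 hmem
    rw [← ha, inner_smul_right, inner_self_eq_norm_sq_to_K, hu1]
    simp
  have hud := (hu.contDiffOn.differentiableOn one_ne_zero t ht).hasDerivWithinAt
  have hvd := (hv.contDiffOn.differentiableOn one_ne_zero t ht).hasDerivWithinAt
  have hU := (uniqueDiffOn_Icc (zero_lt_one' ℝ)) t ht
  have hc : HasDerivWithinAt (fun s => inner ℂ (u s) (v s)) _ (Icc 0 1) t := hud.inner ℂ hvd
  have hcu := hc.smul hud
  have hv' := hcu.congr key (key t ht)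
  obtain ⟨a, hd⟩ : ∃ a : ℂ, derivWithin v (Icc 0 1) t
      = inner ℂ (u t) (v t) • derivWithin u (Icc 0 1) t + a • u t := ⟨_, hv'.derivWithin hU⟩
  obtain ⟨hu1, -⟩ := hu.represents t ht
  obtain ⟨hv1, -⟩ := hv.represents t ht
  set c : ℂ := inner ℂ (u t) (v t) with hcdef
  have hvt : v t = c • u t := key t ht
  have hc1 : ‖c‖ = 1 := by
    have h := congrArg norm hvt
    rw [norm_smul, hu1, hv1] at h
    linarith
  have hcc : c * conj c = 1 := by
    rw [Complex.mul_conj, Complex.normSq_eq_norm_sq, hc1]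
    simp
  have huu : inner ℂ (u t) (u t) = (1 : ℂ) := by
    rw [inner_self_eq_norm_sq_to_K, hu1]
    simp
  have hH : horizontalPart (v t) (derivWithin v (Icc 0 1) t)
      = c • horizontalPart (u t) (derivWithin u (Icc 0 1) t) := by
    rw [hd]
    unfold horizontalPart
    rw [hvt]
    simp only [inner_smul_left, inner_add_right, inner_smul_right, huu, smul_sub, smul_smul]
    match_scalars
    · ring
    · linear_combination (-(c * inner ℂ (u t) (derivWithin u (Icc 0 1) t)) - a) * hcc
  unfold speed
  rw [hH, norm_smul, hc1, one_mul]

/-- `γ` is a shortest path from `X` to `Y` on the time interval `[0, 1]`, parametrized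
proportionally to arc length: it is a `C¹` path from `X` to `Y` of constant speed, and no `C¹`
path from `X` to `Y` has smaller Riemannian length. -/
def IsShortestGeodesic {n : ℕ} (γ : ℝ → GrassmannLine n) (X Y : GrassmannLine n) : Prop :=
  γ 0 = X ∧ γ 1 = Y ∧ ∃ u : ℝ → Cn n, IsLift u γ ∧
    (∃ c : ℝ, ∀ t ∈ Icc (0 : ℝ) 1, speed u t = c) ∧
    ∀ (σ : ℝ → GrassmannLine n) (v : ℝ → Cn n), IsLift v σ → σ 0 = X → σ 1 = Y →
      pathLength u ≤ pathLength v

/-- `γ` satisfies the geodesic equation of the canonical Riemannian metric on `[0, 1]`: it has a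
`C²` horizontal lift `u` whose acceleration has zero horizontal part (this is the vanishing of the
covariant derivative of the velocity of `γ`). -/
def SatisfiesGeodesicEquation {n : ℕ} (γ : ℝ → GrassmannLine n) : Prop :=
  ∃ u : ℝ → Cn n, IsLift u γ ∧ ContDiffOn ℝ 2 u (Icc 0 1) ∧
    ∀ t ∈ Icc (0 : ℝ) 1, inner ℂ (u t) (derivWithin u (Icc 0 1) t) = (0 : ℂ) ∧
      horizontalPart (u t) (iteratedDerivWithin 2 u (Icc 0 1) t) = 0

end

/-! Write θ for the distance of two lines, so that `|a* x| = cos θ` for unit representatives. The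
curve is a great circle arc in the real plane of `x₁` and `e/‖e‖`; as `x₁* e = 0`, it is horizontal,
has speed `‖e‖`, and its acceleration is a multiple of itself, hence vertical. Its length is `‖e‖ =
arccos |ρ|`.

Minimality: along any C¹ path, the distance to a fixed line changes at most at the speed of the path
(`IsLift.abs_arccos_sub_le`). The proof uses `arccos (2|a* x|² - 1) = 2θ`, because `|a* x|²` is
smooth even where `a* x = 0`. Applied to `a = x₁` over `[0, 1]` this bounds every length below by
`‖e‖`.

Uniqueness: at time `t`, a constant-speed minimizer is within `‖e‖t` of the start and `‖e‖(1 - t)`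
of the end. Since `ρ ≠ 0` forces `‖e‖ < π/2`, equality in the triangle inequality is rigid
(`one_le_norm_inner_of_cos_sq_le`), so the path agrees with the geodesic at each time. -/

/-! ### Horizontal components and the distance function. -/

theorem inner_self_of_norm_eq_one {n : ℕ} {x : Cn n} (hx : ‖x‖ = 1) :
    inner ℂ x x = (1 : ℂ) := by
  rw [inner_self_eq_norm_sq_to_K, hx]
  simp

theorem inner_horizontalPart {n : ℕ} {x : Cn n} (hx : ‖x‖ = 1) (v : Cn n) :
    inner ℂ x (horizontalPart x v) = (0 : ℂ) := by
  rw [horizontalPart, inner_sub_right, inner_smul_right, inner_self_of_norm_eq_one hx, mul_one,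
    sub_self]

theorem norm_horizontalPart_sq {n : ℕ} {x a : Cn n} (hx : ‖x‖ = 1) (ha : ‖a‖ = 1) :
    ‖horizontalPart x a‖ ^ 2 = 1 - ‖inner ℂ a x‖ ^ 2 := by
  have h := norm_add_sq_eq_norm_sq_add_norm_sq_of_inner_eq_zero (𝕜 := ℂ)
    ((inner ℂ x a : ℂ) • x) (horizontalPart x a)
    (by rw [inner_smul_left, inner_horizontalPart hx, mul_zero])
  have h' : (inner ℂ x a : ℂ) • x + horizontalPart x a = a := by
    rw [horizontalPart]; abel
  rw [h', ha, norm_smul, hx, norm_inner_symm x a] at h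
  linarith

/-- Only the component of `a` orthogonal to `x`, of norm sin θ, pairs with a horizontal `h`; then
Cauchy–Schwarz. -/
theorem norm_inner_horizontal_le {n : ℕ} {x a h : Cn n} (hx : ‖x‖ = 1) (ha : ‖a‖ = 1)
    (hh : inner ℂ x h = (0 : ℂ)) :
    ‖inner ℂ a h‖ ≤ √(1 - ‖inner ℂ a x‖ ^ 2) * ‖h‖ := by
  have h1 : inner ℂ a h = (inner ℂ (horizontalPart x a) h : ℂ) := by
    rw [horizontalPart, inner_sub_left, inner_smul_left, hh, mul_zero, sub_zero]
  rw [h1, ← norm_horizontalPart_sq hx ha, Real.sqrt_sq (norm_nonneg _)]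
  exact norm_inner_le_norm _ _

/-- Twice the squared modulus of `a* x`, minus one: the cosine of twice the distance of the lines
spanned by unit vectors `a` and `x`. -/
noncomputable def cosTwiceDist {n : ℕ} (a x : Cn n) : ℝ :=
  2 * ‖inner ℂ a x‖ ^ 2 - 1

theorem norm_inner_sq_le_one {n : ℕ} {a x : Cn n} (ha : ‖a‖ = 1) (hx : ‖x‖ = 1) :
    ‖inner ℂ a x‖ ^ 2 ≤ 1 := by
  have h : ‖inner ℂ a x‖ ≤ 1 := by simpa [ha, hx] using norm_inner_le_norm (𝕜 := ℂ) a x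
  exact pow_le_one₀ (norm_nonneg _) h

theorem abs_cosTwiceDist_le_one {n : ℕ} {a x : Cn n} (ha : ‖a‖ = 1) (hx : ‖x‖ = 1) :
    |cosTwiceDist a x| ≤ 1 := by
  have h := norm_inner_sq_le_one ha hx
  rw [abs_le, cosTwiceDist]
  constructor <;> nlinarith [sq_nonneg ‖inner ℂ a x‖]

/-! ### Variation of the distance to a fixed line along a path. -/

theorem IsLift.continuousOn_speed {n : ℕ} {u : ℝ → Cn n} {γ : ℝ → GrassmannLine n}
    (hu : IsLift u γ) : ContinuousOn (speed u) (Icc 0 1) := by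
  have h1 := hu.contDiffOn.continuousOn
  have h2 := hu.contDiffOn.continuousOn_derivWithin (uniqueDiffOn_Icc (zero_lt_one' ℝ)) le_rfl
  unfold speed horizontalPart
  have h3 : ContinuousOn (fun t => (inner ℂ (u t) (derivWithin u (Icc 0 1) t) : ℂ)) (Icc 0 1) :=
    h1.inner h2
  exact (h2.sub (h3.smul h1)).norm

/-- The bound is `|d/dt cos 2θ| ≤ 2 sin 2θ · speed`, i.e. `|θ'| ≤ speed` in a form that needs no
differentiability of θ. -/
theorem IsLift.exists_hasDerivAt_cosTwiceDist {n : ℕ} {u : ℝ → Cn n} {γ : ℝ → GrassmannLine n}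
    (hu : IsLift u γ) {a : Cn n} (ha : ‖a‖ = 1) {t : ℝ} (ht : t ∈ Ioo (0 : ℝ) 1) :
    ∃ d : ℝ, HasDerivAt (fun s => cosTwiceDist a (u s)) d t ∧
      |d| ≤ 2 * √(1 - cosTwiceDist a (u t) ^ 2) * speed u t := by
  have hmem : Icc (0 : ℝ) 1 ∈ nhds t := Icc_mem_nhds ht.1 ht.2
  have htI := Ioo_subset_Icc_self ht
  have hux := (hu.represents t htI).1
  have hd : HasDerivAt u (derivWithin u (Icc 0 1) t) t :=
    (hu.contDiffOn.differentiableOn one_ne_zero t htI).hasDerivWithinAt.hasDerivAt hmem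
  set x := u t with hxdef
  set v := derivWithin u (Icc 0 1) t with hvdef
  -- Differentiating `u* u = 1` makes `x* v` purely imaginary: the vertical velocity is an
  -- infinitesimal phase change, which does not affect `|a* u|²`.
  have hre : (inner ℂ x v : ℂ).re = 0 := by
    have h1 : HasDerivAt (fun s => (inner ℂ (u s) (u s) : ℂ)) _ t := hd.inner ℂ hd
    have h2 : HasDerivAt (fun s => (inner ℂ (u s) (u s) : ℂ)) 0 t := by
      refine (hasDerivAt_const t (1 : ℂ)).congr_of_eventuallyEq ?_
      filter_upwards [hmem] with s hs
      exact inner_self_of_norm_eq_one (hu.represents s hs).1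
    have h3 := congrArg Complex.re (h1.unique h2)
    have h4 : (inner ℂ v x : ℂ).re = (inner ℂ x v : ℂ).re := by
      rw [← inner_conj_symm, Complex.conj_re]
    rw [← hxdef, Complex.add_re, h4, Complex.zero_re] at h3
    linarith
  have hz : HasDerivAt (fun s => (inner ℂ a (u s) : ℂ)) (inner ℂ a v) t := by
    have := (hasDerivAt_const t a).inner ℂ hd
    simpa using this
  have hF := hz.norm_sq
  set z : ℂ := inner ℂ a x with hzdef
  have hin : inner ℝ z (inner ℂ a v : ℂ)
      = inner ℝ z (inner ℂ a (horizontalPart x v) : ℂ) := by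
    rw [horizontalPart, inner_sub_right, inner_smul_right, ← hzdef]
    simp only [Complex.inner, Complex.mul_re, Complex.sub_re, Complex.sub_im,
      Complex.mul_im, Complex.conj_re, Complex.conj_im, hre]
    ring
  refine ⟨2 * (2 * inner ℝ z (inner ℂ a v : ℂ)), (hF.const_mul 2).sub_const 1, ?_⟩
  have hb := norm_inner_horizontal_le hux ha (inner_horizontalPart hux v)
  rw [← hzdef] at hb
  have hle := norm_inner_sq_le_one ha hux
  rw [← hzdef] at hle
  -- This is sin 2θ = 2 cos θ sin θ.
  have hsq : √(1 - cosTwiceDist a x ^ 2) = 2 * ‖z‖ * √(1 - ‖z‖ ^ 2) := by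
    have : 1 - cosTwiceDist a x ^ 2 = (2 * ‖z‖) ^ 2 * (1 - ‖z‖ ^ 2) := by
      rw [cosTwiceDist, ← hzdef]; ring
    rw [this, Real.sqrt_mul (sq_nonneg _), Real.sqrt_sq (by positivity)]
  have hcs := abs_real_inner_le_norm z (inner ℂ a (horizontalPart x v) : ℂ)
  rw [hin, hsq, abs_mul, abs_mul, abs_two]
  have hsp : speed u t = ‖horizontalPart x v‖ := rfl
  rw [hsp]
  have := mul_le_mul_of_nonneg_left hb (norm_nonneg z)
  nlinarith

/-- The factor `l` keeps the argument of `arcsin` away from ±1, where `arcsin` is not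
differentiable; these values occur when the moving line equals or is orthogonal to that of `a`.
Shrinking by `l` only weakens the derivative, so the bound survives. -/
theorem IsLift.arcsin_sub_le {n : ℕ} {u : ℝ → Cn n} {γ : ℝ → GrassmannLine n}
    (hu : IsLift u γ) {a : Cn n} (ha : ‖a‖ = 1) {l : ℝ} (hl : |l| < 1) {s t : ℝ}
    (hs : 0 ≤ s) (hst : s ≤ t) (ht : t ≤ 1) :
    Real.arcsin (l * cosTwiceDist a (u t)) - Real.arcsin (l * cosTwiceDist a (u s))
      ≤ ∫ r in s..t, 2 * speed u r := by
  have hsub : Icc s t ⊆ Icc 0 1 := Icc_subset_Icc hs ht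
  have hsub' : Ioo s t ⊆ Ioo 0 1 := Ioo_subset_Ioo hs ht
  have hcont : ContinuousOn (fun r => cosTwiceDist a (u r)) (Icc s t) := by
    unfold cosTwiceDist
    have := hu.contDiffOn.continuousOn.mono hsub
    fun_prop
  choose! d hd hdb using fun r (hr : r ∈ Ioo s t) =>
    hu.exists_hasDerivAt_cosTwiceDist ha (hsub' hr)
  have hlt : ∀ r ∈ Ioo s t, |l * cosTwiceDist a (u r)| < 1 := by
    intro r hr
    have h1 := abs_cosTwiceDist_le_one ha (hu.represents r (Ioo_subset_Icc_self (hsub' hr))).1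
    rw [abs_mul]
    exact (mul_le_of_le_one_right (abs_nonneg l) h1).trans_lt hl
  refine intervalIntegral.sub_le_integral_of_hasDeriv_right_of_le
    (g := fun r => Real.arcsin (l * cosTwiceDist a (u r)))
    (g' := fun r => 1 / √(1 - (l * cosTwiceDist a (u r)) ^ 2) * (l * d r)) hst
    (Real.continuous_arcsin.comp_continuousOn (continuousOn_const.mul hcont)) ?_ ?_ ?_
  · intro r hr
    have h := abs_lt.1 (hlt r hr)
    exact ((Real.hasDerivAt_arcsin h.1.ne' h.2.ne).comp r
      ((hd r hr).const_mul l)).hasDerivWithinAt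
  · exact ((hu.continuousOn_speed.mono hsub).const_smul (2 : ℝ)).integrableOn_Icc
  · intro r hr
    have h := hlt r hr
    set f := cosTwiceDist a (u r) with hf
    have hpos : 0 < 1 - (l * f) ^ 2 := by
      have := (sq_lt_one_iff_abs_lt_one _).2 h
      linarith
    have hmono : √(1 - f ^ 2) ≤ √(1 - (l * f) ^ 2) := by
      apply Real.sqrt_le_sqrt
      have := (sq_lt_one_iff_abs_lt_one _).2 hl
      nlinarith [sq_nonneg f]
    have hsp : 0 ≤ speed u r := norm_nonneg _
    have h1 : l * d r ≤ 2 * √(1 - (l * f) ^ 2) * speed u r := by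
      calc l * d r ≤ |l| * |d r| := by rw [← abs_mul]; exact le_abs_self _
        _ ≤ |d r| := mul_le_of_le_one_left (abs_nonneg _) hl.le
        _ ≤ _ := hdb r hr
        _ ≤ _ := by gcongr
    rw [one_div, inv_mul_le_iff₀ (Real.sqrt_pos.2 hpos)]
    linarith

/-- The distance to a fixed line grows at most at the speed of the path. -/
theorem IsLift.abs_arccos_sub_le {n : ℕ} {u : ℝ → Cn n} {γ : ℝ → GrassmannLine n}
    (hu : IsLift u γ) {a : Cn n} (ha : ‖a‖ = 1) {s t : ℝ}
    (hs : 0 ≤ s) (hst : s ≤ t) (ht : t ≤ 1) :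
    |Real.arccos (cosTwiceDist a (u t)) - Real.arccos (cosTwiceDist a (u s))|
      ≤ ∫ r in s..t, 2 * speed u r := by
  -- Let the scaling factor tend to `l = ±1` from inside; the two signs give the two halves of the
  -- absolute value.
  have key : ∀ l : ℝ, |l| = 1 →
      Real.arcsin (l * cosTwiceDist a (u t)) - Real.arcsin (l * cosTwiceDist a (u s))
      ≤ ∫ r in s..t, 2 * speed u r := by
    intro l hl
    have hc : Continuous fun c : ℝ => Real.arcsin (c * l * cosTwiceDist a (u t)) -
        Real.arcsin (c * l * cosTwiceDist a (u s)) := by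
      have := Real.continuous_arcsin
      fun_prop
    have h := (hc.tendsto 1).mono_left (nhdsWithin_le_nhds (s := Ioo (0 : ℝ) 1))
    simp only [one_mul] at h
    have : (nhdsWithin (1 : ℝ) (Ioo 0 1)).NeBot := right_nhdsWithin_Ioo_neBot zero_lt_one
    refine le_of_tendsto h ?_
    filter_upwards [self_mem_nhdsWithin] with c hc
    refine hu.arcsin_sub_le ha ?_ hs hst ht
    rw [abs_mul, hl, mul_one, abs_of_pos hc.1]
    exact hc.2
  have h1 := key 1 (by simp)
  have h2 := key (-1) (by simp)
  simp only [neg_mul, one_mul, Real.arcsin_neg] at h1 h2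
  rw [abs_le, Real.arccos, Real.arccos]
  constructor <;> linarith

theorem cos_sq_le_of_arccos_cosTwiceDist_le {n : ℕ} {a x : Cn n} (ha : ‖a‖ = 1) (hx : ‖x‖ = 1)
    {φ : ℝ} (hφ : 2 * φ ≤ Real.pi) (h : Real.arccos (cosTwiceDist a x) ≤ 2 * φ) :
    Real.cos φ ^ 2 ≤ ‖inner ℂ a x‖ ^ 2 := by
  have h1 := abs_le.1 (abs_cosTwiceDist_le_one ha hx)
  have h2 := Real.cos_le_cos_of_nonneg_of_le_pi (Real.arccos_nonneg _) hφ h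
  rw [Real.cos_arccos h1.1 h1.2, Real.cos_two_mul, cosTwiceDist] at h2
  linarith

theorem arccos_cosTwiceDist_eq {n : ℕ} {a x : Cn n} {φ : ℝ} (h0 : 0 ≤ φ) (hφ : 2 * φ ≤ Real.pi)
    (h : ‖inner ℂ a x‖ = Real.cos φ) : Real.arccos (cosTwiceDist a x) = 2 * φ := by
  rw [cosTwiceDist, h, ← Real.cos_two_mul, Real.arccos_cos (by linarith) hφ]

/-! ### Great circle arcs, their geodesic equation, and rigidity. -/

section GeodesicCurve

variable {n : ℕ} {x e : Cn n}

theorem norm_smul_inv_norm_smul (e : Cn n) : ‖e‖ • (‖e‖⁻¹ • e) = e := by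
  by_cases h : e = 0
  · simp [h]
  · rw [smul_smul, mul_inv_cancel₀ (norm_ne_zero_iff.2 h), one_smul]

theorem geodesicCurve_zero_right (x : Cn n) (t : ℝ) : geodesicCurve x 0 t = x := by
  simp [geodesicCurve]

theorem geodesicCurve_zero (x e : Cn n) : geodesicCurve x e 0 = x := by
  simp [geodesicCurve]

theorem inner_real_smul_right (a b : Cn n) (r : ℝ) :
    inner ℂ a (r • b) = (r : ℂ) * inner ℂ a b := by
  rw [inner_smul_right_eq_smul, Complex.real_smul]

theorem inner_real_smul_left (a b : Cn n) (r : ℝ) :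
    inner ℂ (r • a) b = (r : ℂ) * inner ℂ a b := by
  rw [inner_smul_left_eq_smul, Complex.real_smul]

theorem inner_comb (hx : ‖x‖ = 1) {w : Cn n} (hw : ‖w‖ = 1) (hxw : inner ℂ x w = (0 : ℂ))
    (a b c d : ℝ) :
    inner ℂ (a • x + b • w) (c • x + d • w) = ((a * c + b * d : ℝ) : ℂ) := by
  have hwx : inner ℂ w x = (0 : ℂ) := by rw [← inner_conj_symm, hxw, map_zero]
  simp only [inner_add_left, inner_add_right, inner_real_smul_left, inner_real_smul_right, hxw,
    hwx, inner_self_of_norm_eq_one hx, inner_self_of_norm_eq_one hw]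
  push_cast
  ring

theorem norm_comb_sq (hx : ‖x‖ = 1) {w : Cn n} (hw : ‖w‖ = 1) (hxw : inner ℂ x w = (0 : ℂ))
    (a b : ℝ) : ‖a • x + b • w‖ ^ 2 = a ^ 2 + b ^ 2 := by
  have h := inner_comb hx hw hxw a b a b
  rw [inner_self_eq_norm_sq_to_K] at h
  have h' : ((‖a • x + b • w‖ ^ 2 : ℝ) : ℂ) = ((a ^ 2 + b ^ 2 : ℝ) : ℂ) := by
    rw [sq a, sq b, ← h]
    push_cast
    rfl
  exact_mod_cast h'

theorem norm_normalize (he : e ≠ 0) : ‖‖e‖⁻¹ • e‖ = 1 := by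
  rw [norm_smul, norm_inv, norm_norm, inv_mul_cancel₀ (norm_ne_zero_iff.2 he)]

theorem inner_normalize (hxe : inner ℂ x e = (0 : ℂ)) : inner ℂ x (‖e‖⁻¹ • e) = (0 : ℂ) := by
  rw [inner_real_smul_right, hxe, mul_zero]

theorem norm_geodesicCurve (hx : ‖x‖ = 1) (hxe : inner ℂ x e = (0 : ℂ)) (t : ℝ) :
    ‖geodesicCurve x e t‖ = 1 := by
  -- For `e = 0` the vector `‖e‖⁻¹ • e` is zero rather than a unit vector, so this case is separate.
  by_cases he : e = 0
  · rw [he, geodesicCurve_zero_right, hx]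
  · have h := norm_comb_sq hx (norm_normalize he) (inner_normalize hxe)
      (Real.cos (‖e‖ * t)) (Real.sin (‖e‖ * t))
    rw [Real.cos_sq_add_sin_sq] at h
    exact (pow_eq_one_iff_of_nonneg (norm_nonneg _) two_ne_zero).1 h

theorem contDiff_geodesicCurve (x e : Cn n) : ContDiff ℝ 2 (geodesicCurve x e) := by
  unfold geodesicCurve
  have := Real.contDiff_sin (n := 2)
  have := Real.contDiff_cos (n := 2)
  fun_prop

/-- The velocity of `geodesicCurve x e`. -/
noncomputable def geodesicVelocity (x e : Cn n) (t : ℝ) : Cn n :=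
  ‖e‖ • ((-Real.sin (‖e‖ * t)) • x + Real.cos (‖e‖ * t) • (‖e‖⁻¹ • e))

theorem hasDerivAt_geodesicCurve (x e : Cn n) (t : ℝ) :
    HasDerivAt (geodesicCurve x e) (geodesicVelocity x e t) t := by
  have hl : HasDerivAt (fun s : ℝ => ‖e‖ * s) ‖e‖ t := by
    simpa using (hasDerivAt_id t).const_mul ‖e‖
  have h := (hl.cos.smul_const x).add (hl.sin.smul_const (‖e‖⁻¹ • e))
  refine h.congr_deriv ?_
  rw [geodesicVelocity]
  module

theorem hasDerivAt_geodesicVelocity (x e : Cn n) (t : ℝ) :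
    HasDerivAt (geodesicVelocity x e) (-(‖e‖ ^ 2) • geodesicCurve x e t) t := by
  have hl : HasDerivAt (fun s : ℝ => ‖e‖ * s) ‖e‖ t := by
    simpa using (hasDerivAt_id t).const_mul ‖e‖
  have h := ((hl.sin.neg.smul_const x).add (hl.cos.smul_const (‖e‖⁻¹ • e))).const_smul ‖e‖
  refine h.congr_deriv ?_
  rw [geodesicCurve]
  module

theorem inner_geodesicCurve_velocity (hx : ‖x‖ = 1) (hxe : inner ℂ x e = (0 : ℂ)) (t : ℝ) :
    inner ℂ (geodesicCurve x e t) (geodesicVelocity x e t) = (0 : ℂ) := by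
  by_cases he : e = 0
  · simp [he, geodesicVelocity]
  · rw [geodesicVelocity, inner_real_smul_right, geodesicCurve,
      inner_comb hx (norm_normalize he) (inner_normalize hxe)]
    have : Real.cos (‖e‖ * t) * -Real.sin (‖e‖ * t) + Real.sin (‖e‖ * t) * Real.cos (‖e‖ * t)
      = 0 := by ring
    rw [this, Complex.ofReal_zero, mul_zero]

theorem norm_geodesicVelocity (hx : ‖x‖ = 1) (hxe : inner ℂ x e = (0 : ℂ)) (t : ℝ) :
    ‖geodesicVelocity x e t‖ = ‖e‖ := by
  by_cases he : e = 0
  · simp [he, geodesicVelocity]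
  · have h := norm_comb_sq hx (norm_normalize he) (inner_normalize hxe)
      (-Real.sin (‖e‖ * t)) (Real.cos (‖e‖ * t))
    rw [neg_sq, Real.sin_sq_add_cos_sq] at h
    rw [geodesicVelocity, norm_smul, norm_norm,
      (pow_eq_one_iff_of_nonneg (norm_nonneg _) two_ne_zero).1 h, mul_one]

theorem derivWithin_geodesicCurve (x e : Cn n) {t : ℝ} (ht : t ∈ Icc (0 : ℝ) 1) :
    derivWithin (geodesicCurve x e) (Icc 0 1) t = geodesicVelocity x e t :=
  (hasDerivAt_geodesicCurve x e t).hasDerivWithinAt.derivWithin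
    (uniqueDiffOn_Icc (zero_lt_one' ℝ) t ht)

theorem iteratedDerivWithin_two_geodesicCurve (x e : Cn n) {t : ℝ} (ht : t ∈ Icc (0 : ℝ) 1) :
    iteratedDerivWithin 2 (geodesicCurve x e) (Icc 0 1) t
      = -(‖e‖ ^ 2) • geodesicCurve x e t := by
  rw [iteratedDerivWithin_succ, iteratedDerivWithin_one,
    derivWithin_congr (fun s hs => derivWithin_geodesicCurve x e hs)
      (derivWithin_geodesicCurve x e ht)]
  exact (hasDerivAt_geodesicVelocity x e t).hasDerivWithinAt.derivWithin
    (uniqueDiffOn_Icc (zero_lt_one' ℝ) t ht)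

theorem speed_geodesicCurve (hx : ‖x‖ = 1) (hxe : inner ℂ x e = (0 : ℂ)) {t : ℝ}
    (ht : t ∈ Icc (0 : ℝ) 1) : speed (geodesicCurve x e) t = ‖e‖ := by
  rw [speed, derivWithin_geodesicCurve x e ht, horizontalPart,
    inner_geodesicCurve_velocity hx hxe, zero_smul, sub_zero, norm_geodesicVelocity hx hxe]

/-- The acceleration `-‖e‖² G` lies in the line spanned by `G` itself, so its horizontal part
vanishes. -/
theorem satisfiesGeodesicEquation_of_geodesicCurve (hx : ‖x‖ = 1) (hxe : inner ℂ x e = (0 : ℂ))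
    {γ : ℝ → GrassmannLine n} (hγ : IsLift (geodesicCurve x e) γ) :
    SatisfiesGeodesicEquation γ := by
  refine ⟨_, hγ, (contDiff_geodesicCurve x e).contDiffOn, fun t ht => ⟨?_, ?_⟩⟩
  · rw [derivWithin_geodesicCurve x e ht, inner_geodesicCurve_velocity hx hxe]
  · rw [iteratedDerivWithin_two_geodesicCurve x e ht, horizontalPart, inner_real_smul_right,
      inner_self_of_norm_eq_one (norm_geodesicCurve hx hxe t), mul_one, sub_eq_zero]
    exact (Complex.coe_smul _ _).symm

theorem pathLength_eq_of_speed_eq {u : ℝ → Cn n} {c : ℝ}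
    (h : ∀ t ∈ Icc (0 : ℝ) 1, speed u t = c) : pathLength u = c := by
  rw [pathLength, intervalIntegral.integral_congr (g := fun _ => c)
    (fun t ht => h t (by rwa [uIcc_of_le zero_le_one] at ht))]
  simp

/-- A line within distance `φ` of the start and `ψ` of the end of a minimal geodesic of length
`φ + ψ` lies on the geodesic. -/
theorem one_le_norm_inner_of_cos_sq_le {w v : Cn n} (hx : ‖x‖ = 1) (hw : ‖w‖ = 1)
    (hxw : inner ℂ x w = (0 : ℂ)) (hv : ‖v‖ = 1) {φ ψ : ℝ} (hφ : 0 ≤ φ) (hψ : 0 ≤ ψ)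
    (hpos : 0 < φ + ψ) (hlt : φ + ψ < Real.pi / 2)
    (h1 : Real.cos φ ^ 2 ≤ ‖inner ℂ x v‖ ^ 2)
    (h2 : Real.cos ψ ^ 2 ≤
      ‖inner ℂ (Real.cos (φ + ψ) • x + Real.sin (φ + ψ) • w) v‖ ^ 2) :
    1 ≤ ‖inner ℂ (Real.cos φ • x + Real.sin φ • w) v‖ ^ 2 := by
  -- Bessel's inequality for the orthonormal pair `x`, `w`.
  have hbessel : ‖inner ℂ x v‖ ^ 2 + ‖inner ℂ w v‖ ^ 2 ≤ 1 := by
    have hwx : inner ℂ w x = (0 : ℂ) := by rw [← inner_conj_symm, hxw, map_zero]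
    have ho : Orthonormal ℂ ![x, w] := by
      constructor
      · intro i; fin_cases i <;> simp [hx, hw]
      · intro i j hij; fin_cases i <;> fin_cases j <;> simp_all
    have := ho.sum_inner_products_le v (s := Finset.univ)
    simpa [hv] using this
  have hexp : ∀ a b : ℝ, ‖inner ℂ (a • x + b • w) v‖ ^ 2 = a ^ 2 * ‖inner ℂ x v‖ ^ 2
      + b ^ 2 * ‖inner ℂ w v‖ ^ 2 + 2 * a * b * inner ℝ (inner ℂ x v : ℂ) (inner ℂ w v : ℂ) := by
    intro a b
    rw [inner_add_left, inner_real_smul_left, inner_real_smul_left, ← Complex.normSq_eq_norm_sq,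
      ← Complex.normSq_eq_norm_sq, ← Complex.normSq_eq_norm_sq, Complex.inner]
    simp only [Complex.normSq_apply, Complex.add_re, Complex.add_im, Complex.mul_re,
      Complex.mul_im, Complex.ofReal_re, Complex.ofReal_im, Complex.conj_re, Complex.conj_im]
    ring
  rw [hexp] at h2 ⊢
  generalize ‖inner ℂ x v‖ ^ 2 = P at *
  generalize ‖inner ℂ w v‖ ^ 2 = T at *
  generalize inner ℝ (inner ℂ x v : ℂ) (inner ℂ w v : ℂ) = R at *
  have hcφ : 0 ≤ Real.cos φ := Real.cos_nonneg_of_mem_Icc ⟨by linarith, by linarith⟩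
  have hcψ : 0 < Real.cos ψ := Real.cos_pos_of_mem_Ioo ⟨by linarith, by linarith⟩
  have hsφ : 0 ≤ Real.sin φ := Real.sin_nonneg_of_nonneg_of_le_pi hφ (by linarith)
  have hsψ : 0 ≤ Real.sin ψ := Real.sin_nonneg_of_nonneg_of_le_pi hψ (by linarith)
  have hc : 0 < Real.cos (φ + ψ) := Real.cos_pos_of_mem_Ioo ⟨by linarith, by linarith⟩
  have hs : 0 < Real.sin (φ + ψ) := Real.sin_pos_of_pos_of_lt_pi hpos (by linarith)
  have e1 := Real.sin_sq_add_cos_sq φ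
  have e2 := Real.sin_sq_add_cos_sq ψ
  have ec := Real.cos_add φ ψ
  have es := Real.sin_add φ ψ
  set c := Real.cos (φ + ψ)
  set s := Real.sin (φ + ψ)
  set cB := Real.cos φ
  set sB := Real.sin φ
  set cA := Real.cos ψ
  set sA := Real.sin ψ
  have f1 : s * cB - c * sB = sA := by rw [es, ec]; linear_combination sA * e1
  have f2 : c * cB + s * sB = cA := by rw [es, ec]; linear_combination cA * e1
  -- The weights are chosen so that `g1` cancels the cross term `R` from `c s` times the goal, `g2`
  -- then replaces `T` by `1 - P`, and `g3` bounds what remains in `P`. Here `f1`, `f2` are the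
  -- subtraction formulas for `ψ = (φ + ψ) - φ`.
  have g1 := mul_le_mul_of_nonneg_left h2 (mul_nonneg hcφ hsφ)
  have g2 := mul_le_mul_of_nonneg_left hbessel (mul_nonneg (mul_nonneg hs.le hsφ) hsψ)
  have g3 := mul_le_mul_of_nonneg_left h1 (mul_nonneg hsψ hcψ.le)
  have hcs := mul_pos hc hs
  refine le_of_mul_le_mul_left ?_ hcs
  have p1 : c * cB * sA * P = c * cB * (s * cB - c * sB) * P := by rw [f1]
  have p2 : s * sB * sA * T = s * sB * (s * cB - c * sB) * T := by rw [f1]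
  have p3 : sA * cA * P = sA * (c * cB + s * sB) * P := by rw [f2]
  have p4 : sA * cA * cB ^ 2 - s * sB * sA + cB * sB * cA ^ 2 = c * s := by
    rw [ec, es]; ring
  linarith

/-! ### Unit representatives up to phase. -/

theorem Represents.eq_of_norm_inner_eq_one {y : Cn n} {X Y : GrassmannLine n}
    (hx : Represents x X) (hy : Represents y Y) (h : ‖inner ℂ x y‖ = 1) : X = Y := by
  have hx0 : x ≠ 0 := by rw [← norm_ne_zero_iff, hx.1]; exact one_ne_zero
  have hy0 : y ≠ 0 := by rw [← norm_ne_zero_iff, hy.1]; exact one_ne_zero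
  obtain ⟨r, hr, hyx⟩ := (norm_inner_eq_norm_iff (𝕜 := ℂ) hx0 hy0).1 (by rw [h, hx.1, hy.1, mul_one])
  apply Projectivization.submodule_injective
  rw [hx.2, hy.2, hyx, Submodule.span_singleton_smul_eq (IsUnit.mk0 r hr)]

theorem Represents.smul {X : GrassmannLine n} (hx : Represents x X) {c : ℂ} (hc : ‖c‖ = 1) :
    Represents (c • x) X := by
  have hc0 : c ≠ 0 := by rw [← norm_ne_zero_iff, hc]; exact one_ne_zero
  exact ⟨by rw [norm_smul, hc, hx.1, mul_one],
    by rw [hx.2, Submodule.span_singleton_smul_eq (IsUnit.mk0 c hc0)]⟩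

theorem Represents.exists_eq_smul {y : Cn n} {X : GrassmannLine n}
    (hx : Represents x X) (hy : Represents y X) : ∃ c : ℂ, ‖c‖ = 1 ∧ y = c • x := by
  have hmem : y ∈ Submodule.span ℂ {x} := by
    rw [← hx.2, hy.2]
    exact Submodule.mem_span_singleton_self _
  obtain ⟨c, rfl⟩ := Submodule.mem_span_singleton.1 hmem
  refine ⟨c, ?_, rfl⟩
  simpa [norm_smul, hx.1] using hy.1

theorem Represents.norm_inner_eq {a b y : Cn n} {X Y : GrassmannLine n}
    (ha : Represents a X) (hb : Represents b X) (hx : Represents x Y) (hy : Represents y Y) :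
    ‖inner ℂ a x‖ = ‖inner ℂ b y‖ := by
  obtain ⟨c, hc, rfl⟩ := ha.exists_eq_smul hb
  obtain ⟨d, hd, rfl⟩ := hx.exists_eq_smul hy
  simp [hc, hd]

end GeodesicCurve

/-! ### The tangent vector: its length and the end point it reaches. -/

section TangentVec

variable {n : ℕ} {x y : Cn n}

theorem inner_inv_smul_sub (hx : ‖x‖ = 1) (hρ : inner ℂ x y ≠ (0 : ℂ)) :
    inner ℂ x ((inner ℂ x y : ℂ)⁻¹ • y - x) = (0 : ℂ) := by
  rw [inner_sub_right, inner_smul_right, inv_mul_cancel₀ hρ, inner_self_of_norm_eq_one hx, sub_self]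

/-- Pythagoras for `y/ρ = x + (y/ρ - x)`, which is 1 + tan² θ = 1/cos² θ: the horizontal vector `y/ρ
- x` has norm tan θ. -/
theorem one_add_norm_inv_smul_sub_sq (hx : ‖x‖ = 1) (hy : ‖y‖ = 1) (hρ : inner ℂ x y ≠ (0 : ℂ)) :
    1 + ‖(inner ℂ x y : ℂ)⁻¹ • y - x‖ ^ 2 = (‖inner ℂ x y‖ ^ 2)⁻¹ := by
  have h := norm_add_sq_eq_norm_sq_add_norm_sq_of_inner_eq_zero (𝕜 := ℂ) x _
    (inner_inv_smul_sub hx hρ)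
  rw [add_sub_cancel, norm_smul, hx, hy, norm_inv] at h
  rw [← inv_pow]
  linarith

theorem chordalDist_div (hx : ‖x‖ = 1) (hy : ‖y‖ = 1) (hρ : inner ℂ x y ≠ (0 : ℂ)) :
    chordalDist x y / ‖inner ℂ x y‖ = ‖(inner ℂ x y : ℂ)⁻¹ • y - x‖ := by
  have hpos : 0 < ‖inner ℂ x y‖ := norm_pos_iff.2 hρ
  have h := one_add_norm_inv_smul_sub_sq hx hy hρ
  have h2 : 1 - ‖inner ℂ x y‖ ^ 2
      = (‖(inner ℂ x y : ℂ)⁻¹ • y - x‖ * ‖inner ℂ x y‖) ^ 2 := by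
    rw [mul_pow, eq_sub_of_add_eq' h]
    field_simp
  rw [chordalDist, h2, Real.sqrt_sq (by positivity), mul_div_cancel_right₀ _ hpos.ne']

theorem tangentVec_eq (hx : ‖x‖ = 1) (hy : ‖y‖ = 1) (hρ : inner ℂ x y ≠ (0 : ℂ)) :
    tangentVec x y = Real.arctan ‖(inner ℂ x y : ℂ)⁻¹ • y - x‖ •
      (‖(inner ℂ x y : ℂ)⁻¹ • y - x‖⁻¹ • ((inner ℂ x y : ℂ)⁻¹ • y - x)) := by
  rw [tangentVec, chordalDist_div hx hy hρ]

theorem inner_tangentVec (hx : ‖x‖ = 1) (hρ : inner ℂ x y ≠ (0 : ℂ)) :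
    inner ℂ x (tangentVec x y) = (0 : ℂ) := by
  rw [tangentVec, inner_real_smul_right, inner_real_smul_right, inner_inv_smul_sub hx hρ,
    mul_zero, mul_zero]

theorem norm_tangentVec (hx : ‖x‖ = 1) (hy : ‖y‖ = 1) (hρ : inner ℂ x y ≠ (0 : ℂ)) :
    ‖tangentVec x y‖ = Real.arctan ‖(inner ℂ x y : ℂ)⁻¹ • y - x‖ := by
  rw [tangentVec_eq hx hy hρ]
  set w := (inner ℂ x y : ℂ)⁻¹ • y - x
  by_cases hw : w = 0
  · simp [hw]
  · rw [norm_smul, norm_normalize hw, mul_one, Real.norm_of_nonneg]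
    exact Real.arctan_nonneg.2 (norm_nonneg _)

theorem norm_tangentVec_lt (hx : ‖x‖ = 1) (hy : ‖y‖ = 1) (hρ : inner ℂ x y ≠ (0 : ℂ)) :
    ‖tangentVec x y‖ < Real.pi / 2 := by
  rw [norm_tangentVec hx hy hρ]
  exact Real.arctan_lt_pi_div_two _

theorem cos_norm_tangentVec (hx : ‖x‖ = 1) (hy : ‖y‖ = 1) (hρ : inner ℂ x y ≠ (0 : ℂ)) :
    Real.cos ‖tangentVec x y‖ = ‖inner ℂ x y‖ := by
  rw [norm_tangentVec hx hy hρ, Real.cos_arctan, one_add_norm_inv_smul_sub_sq hx hy hρ,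
    Real.sqrt_inv, Real.sqrt_sq (norm_nonneg _), one_div, inv_inv]

/-- The end point is `|ρ| (x + (y/ρ - x))`, so it differs from `y` by the phase `|ρ|/ρ`. -/
theorem geodesicCurve_tangentVec_one (hx : ‖x‖ = 1) (hy : ‖y‖ = 1) (hρ : inner ℂ x y ≠ (0 : ℂ)) :
    geodesicCurve x (tangentVec x y) 1 = ((‖inner ℂ x y‖ : ℂ) * (inner ℂ x y)⁻¹) • y := by
  have hsin : Real.sin ‖tangentVec x y‖
      = ‖(inner ℂ x y : ℂ)⁻¹ • y - x‖ * ‖inner ℂ x y‖ := by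
    rw [norm_tangentVec hx hy hρ, Real.sin_arctan, one_add_norm_inv_smul_sub_sq hx hy hρ,
      Real.sqrt_inv, Real.sqrt_sq (norm_nonneg _), div_inv_eq_mul]
  have hsec : Real.sin ‖tangentVec x y‖ • (‖tangentVec x y‖⁻¹ • tangentVec x y)
      = ‖inner ℂ x y‖ • ((inner ℂ x y : ℂ)⁻¹ • y - x) := by
    rw [hsin, norm_tangentVec hx hy hρ, tangentVec_eq hx hy hρ]
    set w := (inner ℂ x y : ℂ)⁻¹ • y - x
    by_cases hw : w = 0
    · simp [hw]
    · have hw' : 0 < ‖w‖ := norm_pos_iff.2 hw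
      have ha : Real.arctan ‖w‖ ≠ 0 := (Real.arctan_pos.2 hw').ne'
      simp only [smul_smul]
      congr 1
      field_simp
  rw [geodesicCurve, mul_one, cos_norm_tangentVec hx hy hρ, hsec, ← smul_add, add_sub_cancel,
    mul_smul, Complex.coe_smul]

theorem Represents.geodesicCurve_tangentVec_one {Y : GrassmannLine n} (hx : ‖x‖ = 1)
    (hy : Represents y Y) (hρ : inner ℂ x y ≠ (0 : ℂ)) :
    Represents (geodesicCurve x (tangentVec x y) 1) Y := by
  rw [_root_.geodesicCurve_tangentVec_one hx hy.1 hρ]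
  refine hy.smul ?_
  have : ‖inner ℂ x y‖ ≠ 0 := norm_ne_zero_iff.2 hρ
  rw [norm_mul, norm_inv, Complex.norm_real, norm_norm, mul_inv_cancel₀ this]

end TangentVec

/-! ### Minimal length and uniqueness. -/

section Minimality

variable {n : ℕ} {X₁ X₂ : GrassmannLine n} {x₁ x₂ : Cn n}

theorem arccos_cosTwiceDist_of_represents {x y : Cn n} {X : GrassmannLine n}
    (hx : Represents x X) (hy : Represents y X) : Real.arccos (cosTwiceDist x y) = 0 := by
  have h := hx.norm_inner_eq hx hx hy
  rw [inner_self_of_norm_eq_one hx.1, norm_one] at h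
  rw [cosTwiceDist, ← h]
  norm_num

theorem norm_tangentVec_le_pathLength (h₁ : Represents x₁ X₁) (h₂ : Represents x₂ X₂)
    (hρ : inner ℂ x₁ x₂ ≠ (0 : ℂ)) {σ : ℝ → GrassmannLine n} {v : ℝ → Cn n} (hv : IsLift v σ)
    (h0 : σ 0 = X₁) (h1 : σ 1 = X₂) : ‖tangentVec x₁ x₂‖ ≤ pathLength v := by
  have hv0 : Represents (v 0) X₁ := h0 ▸ hv.represents 0 (left_mem_Icc.2 zero_le_one)
  have hv1 : Represents (v 1) X₂ := h1 ▸ hv.represents 1 (right_mem_Icc.2 zero_le_one)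
  have h := (abs_le.1 (hv.abs_arccos_sub_le h₁.1 le_rfl zero_le_one le_rfl)).2
  have hlt := norm_tangentVec_lt h₁.1 h₂.1 hρ
  rw [arccos_cosTwiceDist_of_represents h₁ hv0,
    arccos_cosTwiceDist_eq (φ := ‖tangentVec x₁ x₂‖) (norm_nonneg _) (by linarith)
      ((h₁.norm_inner_eq h₁ hv1 h₂).trans (cos_norm_tangentVec h₁.1 h₂.1 hρ).symm),
    intervalIntegral.integral_const_mul] at h
  rw [pathLength]
  linarith

/-- A path of constant speed at most the distance of its end points stays on the geodesic. -/
theorem IsLift.norm_inner_geodesicCurve_eq_one (h₁ : Represents x₁ X₁) (h₂ : Represents x₂ X₂)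
    (hρ : inner ℂ x₁ x₂ ≠ (0 : ℂ)) {σ : ℝ → GrassmannLine n} {v : ℝ → Cn n} (hv : IsLift v σ)
    (h0 : σ 0 = X₁) (h1 : σ 1 = X₂) {c : ℝ} (hc : ∀ t ∈ Icc (0 : ℝ) 1, speed v t = c)
    (hle : c ≤ ‖tangentVec x₁ x₂‖) {t : ℝ} (ht : t ∈ Icc (0 : ℝ) 1) :
    ‖inner ℂ (geodesicCurve x₁ (tangentVec x₁ x₂) t) (v t)‖ = 1 := by
  have hv0 : Represents (v 0) X₁ := h0 ▸ hv.represents 0 (left_mem_Icc.2 zero_le_one)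
  have hv1 : Represents (v 1) X₂ := h1 ▸ hv.represents 1 (right_mem_Icc.2 zero_le_one)
  have hvt := (hv.represents t ht).1
  have hy := Represents.geodesicCurve_tangentVec_one h₁.1 h₂ hρ
  have hlt := norm_tangentVec_lt h₁.1 h₂.1 hρ
  have hxe := inner_tangentVec h₁.1 hρ
  set e := tangentVec x₁ x₂ with he
  have hGt := norm_geodesicCurve h₁.1 hxe t
  have hint : ∀ a b : ℝ, 0 ≤ a → a ≤ b → b ≤ 1 →
      ∫ r in a..b, 2 * speed v r ≤ 2 * (‖e‖ * (b - a)) := by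
    intro a b ha hab hb
    rw [intervalIntegral.integral_congr (g := fun _ => 2 * c) (fun r hr => by
      rw [uIcc_of_le hab] at hr
      simp only [hc r ⟨ha.trans hr.1, hr.2.trans hb⟩]), intervalIntegral.integral_const,
      smul_eq_mul]
    nlinarith [mul_le_mul_of_nonneg_right hle (sub_nonneg.2 hab)]
  -- Distance from the start over `[0, t]`, then from the end over `[t, 1]`. The end is represented
  -- by the end point of the curve, whose phase fits the rigidity lemma.
  have hd1 := (abs_le.1 (hv.abs_arccos_sub_le h₁.1 le_rfl ht.1 ht.2)).2
  have hd2 := (abs_le.1 (hv.abs_arccos_sub_le hy.1 ht.1 ht.2 le_rfl)).1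
  rw [arccos_cosTwiceDist_of_represents h₁ hv0] at hd1
  rw [arccos_cosTwiceDist_of_represents hy hv1] at hd2
  have hi1 := hint 0 t le_rfl ht.1 ht.2
  have hi2 := hint t 1 ht.1 ht.2 le_rfl
  have hφ : 0 ≤ ‖e‖ * t := mul_nonneg (norm_nonneg _) ht.1
  have hψ : 0 ≤ ‖e‖ * (1 - t) := mul_nonneg (norm_nonneg _) (sub_nonneg.2 ht.2)
  have hsum : ‖e‖ * t + ‖e‖ * (1 - t) = ‖e‖ := by ring
  have hq1 := cos_sq_le_of_arccos_cosTwiceDist_le h₁.1 hvt (φ := ‖e‖ * t) (by linarith)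
    (by rw [sub_zero] at hd1 hi1; linarith)
  have hq2 := cos_sq_le_of_arccos_cosTwiceDist_le hy.1 hvt (φ := ‖e‖ * (1 - t)) (by linarith)
    (by linarith)
  have hge : 1 ≤ ‖inner ℂ (geodesicCurve x₁ e t) (v t)‖ ^ 2 := by
    by_cases he0 : e = 0
    · rw [he0, norm_zero, zero_mul, Real.cos_zero, one_pow] at hq1
      rw [he0, geodesicCurve_zero_right]
      exact hq1
    · have hpos : 0 < ‖e‖ := norm_pos_iff.2 he0
      refine one_le_norm_inner_of_cos_sq_le h₁.1 (norm_normalize he0) (inner_normalize hxe) hvt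
        hφ hψ (by rw [hsum]; exact hpos) (by rw [hsum]; exact hlt) hq1 ?_
      rw [hsum]
      rwa [geodesicCurve, mul_one] at hq2
  exact (pow_eq_one_iff_of_nonneg (norm_nonneg _) two_ne_zero).1
    (le_antisymm (norm_inner_sq_le_one hGt hvt) hge)

end Minimality

theorem lemma2 (n : ℕ) (X₁ X₂ : GrassmannLine n) (x₁ x₂ e : Cn n)
    (h₁ : Represents x₁ X₁) (h₂ : Represents x₂ X₂)
    (hρ : inner ℂ x₁ x₂ ≠ (0 : ℂ)) (he : e = tangentVec x₁ x₂) :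
    (∀ t ∈ Set.Icc (0 : ℝ) 1, ‖geodesicCurve x₁ e t‖ = 1) ∧
    geodesicCurve x₁ e 0 = x₁ ∧
    Represents (geodesicCurve x₁ e 1) X₂ ∧
    inner ℂ x₁ e = (0 : ℂ) ∧
    HasDerivAt (geodesicCurve x₁ e) e 0 ∧
    ∃ γ : ℝ → GrassmannLine n,
      (∀ t ∈ Set.Icc (0 : ℝ) 1, Represents (geodesicCurve x₁ e t) (γ t)) ∧
      SatisfiesGeodesicEquation γ ∧
      IsShortestGeodesic γ X₁ X₂ ∧
      ∀ γ' : ℝ → GrassmannLine n, IsShortestGeodesic γ' X₁ X₂ →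
        ∀ t ∈ Set.Icc (0 : ℝ) 1, γ' t = γ t := by
  subst he
  have hxe := inner_tangentVec h₁.1 hρ
  have hG1 := Represents.geodesicCurve_tangentVec_one h₁.1 h₂ hρ
  set e := tangentVec x₁ x₂ with he
  have hnorm := norm_geodesicCurve h₁.1 hxe
  have hne : ∀ t, geodesicCurve x₁ e t ≠ 0 := fun t => by
    rw [← norm_ne_zero_iff, hnorm t]
    exact one_ne_zero
  have hderiv : HasDerivAt (geodesicCurve x₁ e) e 0 := by
    refine (hasDerivAt_geodesicCurve x₁ e 0).congr_deriv ?_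
    simp only [geodesicVelocity, mul_zero, Real.sin_zero, Real.cos_zero, neg_zero, zero_smul,
      one_smul, zero_add, norm_smul_inv_norm_smul]
  have hrep : ∀ t, Represents (geodesicCurve x₁ e t)
      (Projectivization.mk ℂ (geodesicCurve x₁ e t) (hne t)) :=
    fun t => ⟨hnorm t, Projectivization.submodule_mk _ _⟩
  have hlift : IsLift (geodesicCurve x₁ e)
      (fun t => Projectivization.mk ℂ (geodesicCurve x₁ e t) (hne t)) :=
    ⟨((contDiff_geodesicCurve x₁ e).of_le one_le_two).contDiffOn, fun t _ => hrep t⟩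
  have hspeed : ∀ t ∈ Icc (0 : ℝ) 1, speed (geodesicCurve x₁ e) t = ‖e‖ :=
    fun t ht => speed_geodesicCurve h₁.1 hxe ht
  have hstart : Projectivization.mk ℂ (geodesicCurve x₁ e 0) (hne 0) = X₁ :=
    Projectivization.submodule_injective
      (by rw [(hrep 0).2, h₁.2, geodesicCurve_zero])
  have hend : Projectivization.mk ℂ (geodesicCurve x₁ e 1) (hne 1) = X₂ :=
    Projectivization.submodule_injective (by rw [(hrep 1).2, hG1.2])
  refine ⟨fun t _ => hnorm t, geodesicCurve_zero x₁ e, hG1, hxe, hderiv, _, hlift.represents,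
    satisfiesGeodesicEquation_of_geodesicCurve h₁.1 hxe hlift,
    ⟨hstart, hend, _, hlift, ⟨_, hspeed⟩, fun σ v hv h0 h1 => ?_⟩, ?_⟩
  · rw [pathLength_eq_of_speed_eq hspeed]
    exact norm_tangentVec_le_pathLength h₁ h₂ hρ hv h0 h1
  · rintro γ' ⟨h0, h1, v, hv, ⟨c, hc⟩, hmin⟩ t ht
    -- Comparing the competitor with the geodesic bounds its constant speed by `‖e‖`.
    have hle := hmin _ _ hlift hstart hend
    rw [pathLength_eq_of_speed_eq hspeed, pathLength_eq_of_speed_eq hc] at hle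
    exact ((hrep t).eq_of_norm_inner_eq_one (hv.represents t ht)
      (hv.norm_inner_geodesicCurve_eq_one h₁ h₂ hρ h0 h1 hc hle ht)).symm
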